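/- **Lemma (a Rankine–Hugoniot condition).** Let $\Omega\subset\mathbb R^d$ be bounded, open and connected, and let $\alpha,\beta>1$. Let $G:\mathbb R\to\mathbb R$ be $C^1$, convex and non-decreasing, with $G(z)/z\to\infty$ as $z\to+\infty$, and suppose that for some $C>0$ and all sufficiently large $z$ $$\tfrac{|z|^\alpha}{C}-C\le G(z)\le C(|z|^\alpha+1),\qquad |G'(z)|\le C(|z|^{\alpha-1}+1),\qquad G'(z)z\ge -C .$$ For $\mu\in G'(\mathbb R)$ put $g(\mu)=\max\{z\in\mathbb R: G'(z)=\mu\}$. Let $H:\overline\Omega\times\mathbb R^d\to\mathbb R$ be $C^2$ and bounded below, with $p\mapsto H(x,p)$ strictly convex (for instance uniformly convex) for every $x\in\Omega$, and suppose that for some $C>0$ and all $(x,p)\in\Omega\times\mathbb R^d$ $$\tfrac{|p|^\beta}{C}-C\le H(x,p)\le C(|p|^\beta+1),\quad |D_xH(x,p)|\le C(|p|^\beta+1),\quad |D_pH(x,p)|\le C(|p|^{\beta-1}+1),$$ $$-H(x,p)+D_pH(x,p)\cdot p\ge \tfrac{|p|^\beta}{C}-C .$$ Let $(m,u)\in L^{\alpha'}(\Omega)\times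 W^{1,\gamma}(\Omega)$, where $\alpha'=\alpha/(\alpha-1)$ and $\gamma=\alpha\beta$, be a weak solution in $\Omega$ of the mean-field game system $$H(x,Du)=g(m),\qquad -\operatorname{div}\bigl(m\,D_pH(x,Du)\bigr)=0 ,$$ that is: $m\ge0$ and $m\in G'(\mathbb R)$ a.e. in $\Omega$; $m\,D_pH(x,Du)\in L^1(\Omega)$; $H(x,Du)=g(m)$ a.e. in $\{m>0\}$ and $H(x,Du)\le g(m)$ a.e. in $\Omega$; and the second equation holds in the sense of distributions in $\Omega$. (No condition on $\partial\Omega$ is needed; in particular the statement applies to weak solutions with any boundary conditions, such as mixed Neumann and contact-set conditions.) Fix representatives of $m$ and of the weak gradient $Du$, and let $$F_m:=\partial\{x\in\Omega: m(x)>0\}\cap\Omega$$ be the free boundary of $m$. Let $x_0\in F_m$. Suppose that $F_m$ is $C^1$ near $x_0$ and divides a neighborhood of $x_0$ into two sides, on one of which $m\equiv0$ and on the other of which $m>0$: there are an open set $U$ with $x_0\in U\subset\Omega$ and a function $\rho\in C^1(U)$ with $D\rho\ne0$ on $U$ such that $F_m\cap U=\{x\in U:\rho(x)=0\}$, $m=0$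 on $V_L:=\{x\in U:\rho(x)<0\}$ and $m>0$ on $V_R:=\{x\in U:\rho(x)>0\}$. Suppose also that the one-sided limits $$m_R(x_0)=\lim_{V_R\ni z\to x_0}m(z)\in\mathbb R,\qquad \mathsf v_R(x_0)=\lim_{V_R\ni z\to x_0}Du(z)\in\mathbb R^d$$ exist, and let $\nu(x_0)$ be a unit normal to $F_m$ at $x_0$. Then $$m_R(x_0)\,D_pH(x_0,\mathsf v_R(x_0))\cdot\nu(x_0)=0 ,$$ i.e. the flux at the free boundary is tangential to it. -/

import Mathlib

open MeasureTheory Filter Topology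
open scoped ContDiff

noncomputable section

namespace MFG

/-- Euclidean `d`-space with its inner product norm. -/
abbrev Euc (d : ℕ) : Type := EuclideanSpace ℝ (Fin d)

/-- The free boundary `∂{x ∈ Ω : μ x > 0} ∩ Ω` of a function `μ` on `Ω`. -/
def freeBoundary {d : ℕ} (Ω : Set (Euc d)) (μ : Euc d → ℝ) : Set (Euc d) :=
  frontier {x | x ∈ Ω ∧ 0 < μ x} ∩ Ω

/-- The gradient `D_p H(x, p)` of the Hamiltonian in the momentum variable. -/
def gradP {d : ℕ} (H : Euc d → Euc d → ℝ) (x p : Euc d) : Euc d :=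
  gradient (fun q => H x q) p

/-- The gradient `D_x H(x, p)` of the Hamiltonian in the space variable. -/
def gradX {d : ℕ} (H : Euc d → Euc d → ℝ) (x p : Euc d) : Euc d :=
  gradient (fun y => H y p) x

/-- The pseudo-inverse `g μ = max {z : G' z = μ}` of `G'`.
It is meaningful for `μ` in the range of `G'` (the maximum need not exist otherwise). -/
def pseudoInverse (G : ℝ → ℝ) (μ : ℝ) : ℝ :=
  sSup {z : ℝ | deriv G z = μ}

/-- Assumptions on the energy `G`, with growth exponent `α`. -/
structure EnergyAssumption (G : ℝ → ℝ) (α : ℝ) : Prop where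
  contDiff : ContDiff ℝ 1 G
  coercive : Tendsto (fun z => G z / z) atTop atTop
  convex : ConvexOn ℝ Set.univ G
  monotone : Monotone G
  one_lt : 1 < α
  growth : ∃ C : ℝ, 0 < C ∧ ∀ᶠ z : ℝ in atTop,
    |z| ^ α / C - C ≤ G z ∧ G z ≤ C * (|z| ^ α + 1) ∧ |deriv G z| ≤ C * (|z| ^ (α - 1) + 1)
  deriv_mul_ge : ∃ C : ℝ, 0 < C ∧ ∀ᶠ z : ℝ in atTop, -C ≤ deriv G z * z

/-- Assumptions on the Hamiltonian `H` on `closure Ω × ℝᵈ`, with growth exponent `β`.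
Only strict convexity in `p` is asked for; uniform convexity implies it. -/
structure HamiltonianAssumption {d : ℕ} (Ω : Set (Euc d)) (H : Euc d → Euc d → ℝ) (β : ℝ) :
    Prop where
  contDiffOn : ContDiffOn ℝ 2 (fun z : Euc d × Euc d => H z.1 z.2) (closure Ω ×ˢ Set.univ)
  bddBelow : ∃ c : ℝ, ∀ x ∈ closure Ω, ∀ p, c ≤ H x p
  strictConvex : ∀ x ∈ Ω, StrictConvexOn ℝ Set.univ (H x)
  one_lt : 1 < β
  growth : ∃ C : ℝ, 0 < C ∧ ∀ x ∈ Ω, ∀ p,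
    ‖p‖ ^ β / C - C ≤ H x p ∧ H x p ≤ C * (‖p‖ ^ β + 1) ∧
    ‖gradX H x p‖ ≤ C * (‖p‖ ^ β + 1) ∧
    ‖gradP H x p‖ ≤ C * (‖p‖ ^ (β - 1) + 1)
  lower : ∃ C : ℝ, 0 < C ∧ ∀ x ∈ Ω, ∀ p,
    ‖p‖ ^ β / C - C ≤ -H x p + inner ℝ (gradP H x p) p

/-- `φ ∈ C_c^∞(Ω)`. -/
structure IsTestFunction {d : ℕ} (Ω : Set (Euc d)) (φ : Euc d → ℝ) : Prop where
  smooth : ContDiff ℝ ∞ φ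
  compact : HasCompactSupport φ
  support : tsupport φ ⊆ Ω

/-- `v` is (a representative of) the weak gradient of `u` in `Ω`. -/
def HasWeakGradient {d : ℕ} (Ω : Set (Euc d)) (u : Euc d → ℝ) (v : Euc d → Euc d) : Prop :=
  LocallyIntegrableOn u Ω ∧ LocallyIntegrableOn v Ω ∧
  ∀ φ : Euc d → ℝ, IsTestFunction Ω φ → ∀ e : Euc d,
    ∫ x in Ω, u x * inner ℝ (gradient φ x) e = - ∫ x in Ω, inner ℝ (v x) e * φ x

/-- `(m, u)` is a weak solution in `Ω` of
`H(x, Du) = g(m)`, `-div (m D_pH(x, Du)) = 0`, where `g` is the pseudo-inverse of `G'`;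
`v` is a representative of `Du`. The function spaces are `m ∈ L^{α'}(Ω)`, `u ∈ W^{1,γ}(Ω)`
with `α' = α / (α - 1)` and `γ = α β`. No boundary condition is part of this definition. -/
structure IsWeakSolution {d : ℕ} (Ω : Set (Euc d)) (G : ℝ → ℝ) (H : Euc d → Euc d → ℝ)
    (α β : ℝ) (m u : Euc d → ℝ) (v : Euc d → Euc d) : Prop where
  memLp_m : MemLp m (ENNReal.ofReal (α / (α - 1))) (volume.restrict Ω)
  memLp_u : MemLp u (ENNReal.ofReal (α * β)) (volume.restrict Ω)
  memLp_v : MemLp v (ENNReal.ofReal (α * β)) (volume.restrict Ω)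
  weakGradient : HasWeakGradient Ω u v
  nonneg : ∀ᵐ x ∂(volume.restrict Ω), 0 ≤ m x
  flux_integrable : IntegrableOn (fun x => m x • gradP H x (v x)) Ω
  mem_range : ∀ᵐ x ∂(volume.restrict Ω), m x ∈ Set.range (deriv G)
  hamiltonJacobi_eq : ∀ᵐ x ∂(volume.restrict Ω), 0 < m x → H x (v x) = pseudoInverse G (m x)
  hamiltonJacobi_le : ∀ᵐ x ∂(volume.restrict Ω), H x (v x) ≤ pseudoInverse G (m x)
  continuity : ∀ φ : Euc d → ℝ, IsTestFunction Ω φ →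
    ∫ x in Ω, inner ℝ (m x • gradP H x (v x)) (gradient φ x) = 0

/-- Near `x₀`, the set `F` is a `C¹` hypersurface, with `C¹` defining function `ρ` on the open
neighborhood `U` of `x₀`, and it divides `U` into its two sides `VL = {ρ < 0}` and
`VR = {ρ > 0}`. -/
structure DividesC1 {d : ℕ} (F : Set (Euc d)) (x₀ : Euc d) (U VL VR : Set (Euc d))
    (ρ : Euc d → ℝ) : Prop where
  isOpen : IsOpen U
  mem : x₀ ∈ U
  contDiffOn : ContDiffOn ℝ 1 ρ U
  gradient_ne_zero : ∀ x ∈ U, gradient ρ x ≠ 0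
  eq_zero : F ∩ U = {x | x ∈ U ∧ ρ x = 0}
  left_eq : VL = {x | x ∈ U ∧ ρ x < 0}
  right_eq : VR = {x | x ∈ U ∧ 0 < ρ x}

/-- `ν` is a unit normal at `x₀` to the level set of `ρ` through `x₀` (either orientation). -/
def IsUnitNormal {d : ℕ} (ρ : Euc d → ℝ) (x₀ ν : Euc d) : Prop :=
  ‖ν‖ = 1 ∧ ∃ c : ℝ, ν = c • gradient ρ x₀

end MFG

end

namespace MFG

open scoped NNReal ENNReal RealInnerProductSpace

/-! Only the conservation law matters: the flux `J = m D_pH(x, Du)` is divergence free, vanishes on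
the side `ρ < 0`, and tends to `w = m_R D_pH(x₀, v_R)` from the other side. Blow up at `x₀`: with `n
= Dρ(x₀)`, the fields `y ↦ J (x₀ + ε y)` converge a.e. to `w` on the half-space `{0 < ⟪n, y⟫}` and
to `0` off it, and they are locally bounded because `{ρ = 0}` is null near `x₀`. By dominated
convergence the limit field is again divergence free (`setIntegral_eq_zero_of_blowUp`).

For such a field, sliding a bump along `w` does not change its integral over the half-space. If `⟪n,
w⟫ ≠ 0`, the bump can be slid out of the half-space, where the integral is zero; this contradiction
is `inner_eq_zero_of_setIntegral_halfSpace_eq_zero`. No trace theory or flattening of the boundary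
is needed. -/

/-! ### Level sets of measure zero -/

/-- The zero set of a function is a null set near a point where the derivative is nonzero. -/
lemma exists_nhds_measure_inter_zeroSet_eq_zero {E : Type*} [NormedAddCommGroup E]
    [NormedSpace ℝ E] [FiniteDimensional ℝ E] [MeasurableSpace E] [BorelSpace E]
    (μ : Measure E) [μ.IsAddHaarMeasure] {f : E → ℝ} {f' : E →L[ℝ] ℝ} {a : E}
    (hf : HasStrictFDerivAt f f' a) (hf' : f' ≠ 0) :
    ∃ s ∈ 𝓝 a, μ (s ∩ {x | f x = 0}) = 0 := by
  obtain ⟨e₀, he₀⟩ : ∃ e, f' e ≠ 0 := by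
    by_contra! h
    exact hf' (ContinuousLinearMap.ext h)
  -- The normalization `f' e = 1` gives `f' (Ψ x) = f x` for the chart below.
  set e : E := (f' e₀)⁻¹ • e₀ with he_def
  have he : f' e = 1 := by simp [he_def, he₀]
  -- a local chart `Ψ`, tangent to the identity, which sends `{f = 0}` into `ker f'`
  set Ψ : E → E := fun x => x + (f x - f' x) • e with hΨ
  have hΨd : HasStrictFDerivAt Ψ (ContinuousLinearMap.id ℝ E) a := by
    have h := (hasStrictFDerivAt_id a).add ((hf.sub f'.hasStrictFDerivAt).smul_const e)
    have hid : ContinuousLinearMap.id ℝ E + (f' - f').smulRight e =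
        ContinuousLinearMap.id ℝ E := by
      ext x
      simp
    rwa [hid] at h
  -- Any positive factor below `|det id| = 1` would do: near `a`, `Ψ` shrinks measure by at most
  -- this factor, so a set with null image is null.
  have hdet : ((1 / 2 : ℝ≥0) : ℝ≥0∞) <
      ENNReal.ofReal |(ContinuousLinearMap.id ℝ E).det| := by
    have : (ContinuousLinearMap.id ℝ E).det = 1 := by
      simp [ContinuousLinearMap.det]
    rw [this]
    simp
  obtain ⟨δ, hδ, hδ0⟩ := ((mul_le_addHaar_image_of_lt_det μ (ContinuousLinearMap.id ℝ E)
    hdet).and self_mem_nhdsWithin).exists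
  obtain ⟨s, hs, hsΨ⟩ := hΨd.approximates_deriv_on_nhds (Or.inr hδ0)
  refine ⟨s, hs, ?_⟩
  have hle := hδ _ _ (hsΨ.mono_set (Set.inter_subset_left (t := {x | f x = 0})))
  have himage : μ (Ψ '' (s ∩ {x | f x = 0})) = 0 := by
    refine measure_mono_null ?_ (Measure.addHaar_submodule μ (LinearMap.ker f'.toLinearMap) ?_)
    · rintro _ ⟨x, ⟨-, hx⟩, rfl⟩
      have hx' : f x = 0 := hx
      simp [hΨ, hx', he]
    · intro h
      have : e ∈ LinearMap.ker f'.toLinearMap := h ▸ Submodule.mem_top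
      simp [he] at this
  rw [himage, nonpos_iff_eq_zero, mul_eq_zero] at hle
  exact hle.resolve_left (by simp)

/-! ### Constant fields on half-spaces and blow-up -/

section HalfSpace

variable {E : Type*} [NormedAddCommGroup E] [InnerProductSpace ℝ E] [FiniteDimensional ℝ E]
  [MeasurableSpace E] [BorelSpace E]

/-- Differentiation under the integral sign for translates of a compactly supported function. -/
lemma hasDerivAt_setIntegral_translate (μ : Measure E) [IsFiniteMeasureOnCompacts μ] (S : Set E)
    {φ : E → ℝ} (hφ : ContDiff ℝ ∞ φ) (hc : HasCompactSupport φ) (w : E) (t₀ : ℝ) :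
    HasDerivAt (fun t : ℝ => ∫ y in S, φ (y + t • w) ∂μ)
      (∫ y in S, fderiv ℝ φ (y + t₀ • w) w ∂μ) t₀ := by
  have hφ1 : Continuous (fderiv ℝ φ) := hφ.continuous_fderiv (by simp)
  obtain ⟨C, hC⟩ := (hc.fderiv (𝕜 := ℝ)).exists_bound_of_continuous hφ1
  obtain ⟨R, hR⟩ := hc.isCompact.isBounded.subset_closedBall (0 : E)
  -- `K` contains the supports of all the translates with `|t - t₀| < 1`.
  set K : Set E := Metric.closedBall 0 (R + (|t₀| + 1) * ‖w‖) with hK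
  have hKc : IsCompact K := isCompact_closedBall _ _
  refine (hasDerivAt_integral_of_dominated_loc_of_deriv_le (μ := μ.restrict S)
    (F := fun t y => φ (y + t • w)) (F' := fun t y => fderiv ℝ φ (y + t • w) w)
    (bound := K.indicator fun _ => C * ‖w‖) (Metric.ball_mem_nhds t₀ one_pos)
    ?_ ?_ ?_ ?_ ?_ ?_).2
  · refine Eventually.of_forall fun t => Continuous.aestronglyMeasurable ?_
    exact hφ.continuous.comp (by fun_prop)
  · refine Integrable.restrict ?_
    exact (hφ.continuous.comp (by fun_prop)).integrable_of_hasCompactSupport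
      (hc.comp_homeomorph (Homeomorph.addRight (t₀ • w)))
  · refine Continuous.aestronglyMeasurable ?_
    exact (hφ1.comp (by fun_prop)).clm_apply continuous_const
  · refine Eventually.of_forall fun y t ht => ?_
    by_cases hy : y ∈ K
    · rw [Set.indicator_of_mem hy]
      exact ((fderiv ℝ φ _).le_opNorm w).trans
        (mul_le_mul_of_nonneg_right (hC _) (norm_nonneg _))
    · have hzero : fderiv ℝ φ (y + t • w) = 0 := by
        by_contra h0
        apply hy
        have h1 := hR ((support_fderiv_subset ℝ) (Function.mem_support.2 h0))
        rw [hK, mem_closedBall_zero_iff] at *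
        have h2 : |t| ≤ |t₀| + 1 := by
          rw [Metric.mem_ball, Real.dist_eq] at ht
          have := abs_sub_abs_le_abs_sub t t₀
          linarith
        calc ‖y‖ = ‖(y + t • w) - t • w‖ := by simp
          _ ≤ ‖y + t • w‖ + ‖t • w‖ := norm_sub_le _ _
          _ ≤ R + (|t₀| + 1) * ‖w‖ := by
            rw [norm_smul, Real.norm_eq_abs]
            gcongr
      rw [Set.indicator_of_notMem hy, hzero]
      simp
  · refine Integrable.restrict ?_
    exact (integrable_indicator_iff hKc.measurableSet).2
      (integrableOn_const hKc.measure_lt_top.ne)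
  · refine Eventually.of_forall fun y t _ => ?_
    have h1 : HasDerivAt (fun t : ℝ => y + t • w) w t := by
      simpa using ((hasDerivAt_id t).smul_const w).const_add y
    exact ((hφ.differentiable (by simp)).differentiableAt.hasFDerivAt).comp_hasDerivAt t h1

/-- A constant field `w` on a half-space, extended by zero, is divergence free in the sense of
distributions only if `w` is tangent to the boundary. -/
lemma inner_eq_zero_of_setIntegral_halfSpace_eq_zero (μ : Measure E) [μ.IsAddHaarMeasure]
    {n w : E}
    (h : ∀ φ : E → ℝ, ContDiff ℝ ∞ φ → HasCompactSupport φ →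
      ∫ y in {y : E | 0 < ⟪n, y⟫}, fderiv ℝ φ y w ∂μ = 0) :
    ⟪n, w⟫ = 0 := by
  by_contra hnw
  have hn : n ≠ 0 := by
    rintro rfl
    simp at hnw
  set S : Set E := {y : E | 0 < ⟪n, y⟫} with hS
  have hSo : IsOpen S := isOpen_lt continuous_const (by fun_prop)
  let φ : ContDiffBump (0 : E) := ⟨1, 2, one_pos, one_lt_two⟩
  have hφ : ContDiff ℝ ∞ φ := φ.contDiff
  have hc : HasCompactSupport φ := φ.hasCompactSupport
  have hderiv : ∀ t : ℝ, HasDerivAt (fun t : ℝ => ∫ y in S, φ (y + t • w) ∂μ) 0 t := by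
    intro t
    have h1 := hasDerivAt_setIntegral_translate μ S hφ hc w t
    have h2 := h (fun y => φ (y + t • w)) (hφ.comp (by fun_prop))
      (hc.comp_homeomorph (Homeomorph.addRight (t • w)))
    simp only [fderiv_comp_add_right] at h2
    rwa [h2] at h1
  -- At this time, whatever the sign of `⟪n, w⟫`, points of `S` move to where `⟪n, ·⟫ > 2 * ‖n‖`,
  -- hence beyond the outer radius `2` of the bump.
  have hconst := is_const_of_deriv_eq_zero (fun t => (hderiv t).differentiableAt)
    (fun t => (hderiv t).deriv) 0 (2 * ‖n‖ / ⟪n, w⟫)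
  have hpos : 0 < ∫ y in S, φ y ∂μ := by
    rw [setIntegral_pos_iff_support_of_nonneg_ae (Eventually.of_forall fun y => φ.nonneg)
      (φ.continuous.integrable_of_hasCompactSupport hc).integrableOn, φ.support_eq]
    refine (Metric.isOpen_ball.inter hSo).measure_pos μ ⟨‖n‖⁻¹ • n, ?_, ?_⟩
    · rw [mem_ball_zero_iff, norm_smul, norm_inv, norm_norm,
        inv_mul_cancel₀ (norm_ne_zero_iff.2 hn)]
      exact one_lt_two
    · have : 0 < ‖n‖ := norm_pos_iff.2 hn
      simp only [hS, Set.mem_ofPred_eq, inner_smul_right, real_inner_self_eq_norm_sq]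
      positivity
  have hzero : ∫ y in S, φ (y + (2 * ‖n‖ / ⟪n, w⟫) • w) ∂μ = 0 := by
    refine setIntegral_eq_zero_of_forall_eq_zero fun y hy => ?_
    refine φ.zero_of_le_dist ?_
    rw [dist_zero_right]
    have h1 := real_inner_le_norm n (y + (2 * ‖n‖ / ⟪n, w⟫) • w)
    rw [inner_add_right, inner_smul_right, div_mul_cancel₀ _ hnw] at h1
    have h2 : 0 < ⟪n, y⟫ := hy
    have h3 : 0 < ‖n‖ := norm_pos_iff.2 hn
    change 2 ≤ _
    nlinarith
  simp only [zero_smul, add_zero] at hconst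
  linarith

/-- The blow-up at `x₀` of a locally bounded divergence free field is divergence free. -/
lemma setIntegral_eq_zero_of_blowUp (μ : Measure E) [μ.IsAddHaarMeasure] {Ω : Set E}
    (hΩ : IsOpen Ω) {J : E → E} (hJ : IntegrableOn J Ω μ) {x₀ : E} (hx₀ : x₀ ∈ Ω)
    (hdiv : ∀ φ : E → ℝ, ContDiff ℝ ∞ φ → HasCompactSupport φ → tsupport φ ⊆ Ω →
      ∫ x in Ω, fderiv ℝ φ x (J x) ∂μ = 0)
    {δ M : ℝ} (hδ : 0 < δ) (hM : ∀ᵐ x ∂μ, x ∈ Metric.ball x₀ δ → ‖J x‖ ≤ M)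
    {S : Set E} (hS : MeasurableSet S) {w : E}
    (hlim : ∀ᵐ y ∂μ, Tendsto (fun ε : ℝ => J (x₀ + ε • y)) (𝓝[>] 0)
      (𝓝 (S.indicator (fun _ => w) y)))
    {φ : E → ℝ} (hφ : ContDiff ℝ ∞ φ) (hc : HasCompactSupport φ) :
    ∫ y in S, fderiv ℝ φ y w ∂μ = 0 := by
  obtain ⟨r, hr, hrΩ⟩ := Metric.isOpen_iff.1 hΩ x₀ hx₀
  obtain ⟨R, hR0, hR⟩ := hc.isCompact.isBounded.subset_ball_lt 0 (0 : E)
  have hφ1 : Continuous (fderiv ℝ φ) := hφ.continuous_fderiv (by simp)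
  set J' : E → E := Ω.indicator J with hJ'
  have hJ'i : Integrable J' μ := (integrable_indicator_iff hΩ.measurableSet).2 hJ
  -- For such `ε` the rescaled support lies both in `Ω` and in the ball where `J` is bounded.
  have hsmall : ∀ᶠ ε : ℝ in 𝓝[>] 0, 0 < ε ∧ ε * R < min r δ := by
    have : Tendsto (fun ε : ℝ => ε * R) (𝓝[>] 0) (𝓝 0) := by
      have h : Continuous fun ε : ℝ => ε * R := by fun_prop
      simpa using (h.tendsto 0).mono_left nhdsWithin_le_nhds
    exact (eventually_mem_nhdsWithin).and (this.eventually_lt_const (lt_min hr hδ))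
  have hin : ∀ ε : ℝ, 0 < ε → ε * R < min r δ → ∀ y ∈ tsupport φ,
      x₀ + ε • y ∈ Metric.ball x₀ (min r δ) := by
    intro ε hε hεR y hy
    have h1 := mem_ball_zero_iff.1 (hR hy)
    rw [mem_ball_iff_norm, add_sub_cancel_left, norm_smul, Real.norm_of_nonneg hε.le]
    exact (mul_lt_mul_of_pos_left h1 hε).trans hεR
  have hsupp : ∀ y, y ∉ tsupport φ → fderiv ℝ φ y = 0 := fun y hy => by
    by_contra h0
    exact hy ((support_fderiv_subset ℝ) (Function.mem_support.2 h0))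
  -- the rescaled equation
  have hzero : ∀ᶠ ε : ℝ in 𝓝[>] 0,
      ∫ y, fderiv ℝ φ y (J' (x₀ + ε • y)) ∂μ = 0 := by
    filter_upwards [hsmall] with ε ⟨hε, hεR⟩
    set T : E ≃ₜ E := (Homeomorph.addRight (-x₀)).trans
      (Homeomorph.smulOfNeZero ε⁻¹ (inv_ne_zero hε.ne')) with hT
    have hTapp : ∀ x, T x = ε⁻¹ • (x + -x₀) := fun x => rfl
    set ψ : E → ℝ := fun x => φ (ε⁻¹ • (x + -x₀)) with hψ
    have hψT : ψ = φ ∘ T := rfl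
    have hψc : HasCompactSupport ψ := hc.comp_homeomorph T
    have hψs : ContDiff ℝ ∞ ψ := hφ.comp (by fun_prop)
    have hψΩ : tsupport ψ ⊆ Ω := by
      intro x hx
      have hx1 : T x ∈ tsupport φ := tsupport_comp_subset_preimage φ T.continuous hx
      have hx2 := hin ε hε hεR _ hx1
      rw [hTapp, smul_inv_smul₀ hε.ne'] at hx2
      have hx3 : x ∈ Metric.ball x₀ (min r δ) := by simpa using hx2
      exact hrΩ (Metric.ball_subset_ball (min_le_left _ _) hx3)
    have h0 := hdiv ψ hψs hψc hψΩ
    have hψd : ∀ x z, fderiv ℝ ψ x z = ε⁻¹ * fderiv ℝ φ (ε⁻¹ • (x + -x₀)) z := by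
      intro x z
      have h1 : HasFDerivAt (fun x : E => ε⁻¹ • (x + -x₀))
          (ε⁻¹ • ContinuousLinearMap.id ℝ E) x :=
        ((hasFDerivAt_id x).add_const _).const_smul _
      have h2 := ((hφ.differentiable (by simp)).differentiableAt.hasFDerivAt
        (x := ε⁻¹ • (x + -x₀))).comp x h1
      rw [show ψ = φ ∘ fun x : E => ε⁻¹ • (x + -x₀) from rfl, h2.fderiv]
      simp
    have h1 : ∫ x, fderiv ℝ φ (ε⁻¹ • (x + -x₀)) (J' x) ∂μ = 0 := by
      have h2 : ∫ x, fderiv ℝ ψ x (J' x) ∂μ = 0 := by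
        rw [← h0, ← integral_indicator hΩ.measurableSet]
        congr 1
        ext x
        by_cases hx : x ∈ Ω <;> simp [hJ', hx]
      simp only [hψd] at h2
      rw [integral_const_mul] at h2
      exact (mul_eq_zero.1 h2).resolve_left (inv_ne_zero hε.ne')
    -- Substitute `x = x₀ + ε y`; the Jacobian factor is harmless because the integral is zero.
    rw [← integral_add_left_eq_self _ x₀] at h1
    have h3 := Measure.integral_comp_smul μ
      (fun x => fderiv ℝ φ (ε⁻¹ • (x₀ + x + -x₀)) (J' (x₀ + x))) ε
    rw [h1, smul_zero] at h3
    rw [← h3]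
    congr 1
    ext y
    rw [add_neg_cancel_comm, inv_smul_smul₀ hε.ne']
  have hconv : Tendsto (fun ε : ℝ => ∫ y, fderiv ℝ φ y (J' (x₀ + ε • y)) ∂μ) (𝓝[>] 0)
      (𝓝 (∫ y, S.indicator (fun y => fderiv ℝ φ y w) y ∂μ)) := by
    refine tendsto_integral_filter_of_dominated_convergence (fun y => ‖fderiv ℝ φ y‖ * M)
      ?_ ?_ ?_ ?_
    · filter_upwards [hsmall] with ε hε
      have h1 : AEStronglyMeasurable (fun y => J' (x₀ + ε • y)) μ :=
        ((hJ'i.comp_add_left x₀).comp_smul hε.1.ne').aestronglyMeasurable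
      exact (isBoundedBilinearMap_apply (𝕜 := ℝ) (E := E) (F := ℝ)).continuous
        |>.comp_aestronglyMeasurable₂ hφ1.aestronglyMeasurable h1
    · filter_upwards [hsmall] with ε ⟨hε, hεR⟩
      have hq : ∀ᵐ y ∂μ, x₀ + ε • y ∈ Metric.ball x₀ δ → ‖J (x₀ + ε • y)‖ ≤ M := by
        have h1 : ∀ᵐ x ∂μ, x₀ + x ∈ Metric.ball x₀ δ → ‖J (x₀ + x)‖ ≤ M :=
          (measurePreserving_add_left μ x₀).quasiMeasurePreserving.ae hM
        rw [ae_iff] at h1 ⊢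
        have h2 := Measure.addHaar_preimage_smul μ hε.ne'
          {x | ¬(x₀ + x ∈ Metric.ball x₀ δ → ‖J (x₀ + x)‖ ≤ M)}
        rw [h1, mul_zero] at h2
        exact h2
      filter_upwards [hq] with y hy
      by_cases hys : y ∈ tsupport φ
      · have hb := hin ε hε hεR y hys
        have h1 := hy (Metric.ball_subset_ball (min_le_right _ _) hb)
        have h2 : J' (x₀ + ε • y) = J (x₀ + ε • y) :=
          Set.indicator_of_mem (hrΩ (Metric.ball_subset_ball (min_le_left _ _) hb)) _
        rw [h2]
        exact ((fderiv ℝ φ y).le_opNorm _).trans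
          (mul_le_mul_of_nonneg_left h1 (norm_nonneg _))
      · simp [hsupp y hys]
    · exact (hφ1.norm.mul continuous_const).integrable_of_hasCompactSupport
        ((hc.fderiv (𝕜 := ℝ)).norm.mul_right)
    · filter_upwards [hlim] with y hy
      have h1 : Tendsto (fun ε : ℝ => J' (x₀ + ε • y)) (𝓝[>] 0)
          (𝓝 (S.indicator (fun _ => w) y)) := by
        refine hy.congr' ?_
        have hcont : Tendsto (fun ε : ℝ => x₀ + ε • y) (𝓝[>] 0) (𝓝 x₀) := by
          have h : Continuous fun ε : ℝ => x₀ + ε • y := by fun_prop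
          simpa using (h.tendsto 0).mono_left nhdsWithin_le_nhds
        filter_upwards [hcont (hΩ.mem_nhds hx₀)] with ε hε
        exact (Set.indicator_of_mem (s := Ω) hε J).symm
      have h2 := ((fderiv ℝ φ y).continuous.tendsto _).comp h1
      have h3 : S.indicator (fun y => fderiv ℝ φ y w) y =
          fderiv ℝ φ y (S.indicator (fun _ => w) y) := by
        by_cases hyS : y ∈ S
        · rw [Set.indicator_of_mem hyS, Set.indicator_of_mem hyS]
        · rw [Set.indicator_of_notMem hyS, Set.indicator_of_notMem hyS, map_zero]
      rw [h3]
      exact h2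
  rw [← integral_indicator hS]
  exact tendsto_nhds_unique (hconv.congr' hzero) tendsto_const_nhds

end HalfSpace

/-! ### The flux and its limits along rays -/

/-- Joint continuity turns the one-sided limits of `m` and `Du` into one for the flux. Over the open
set `Ω`, `H` is `C²` on a full neighborhood, and one derivative in `p` leaves `C¹`. -/
lemma HamiltonianAssumption.continuousAt_gradP {d : ℕ} {Ω : Set (Euc d)} (hΩ : IsOpen Ω)
    {H : Euc d → Euc d → ℝ} {β : ℝ} (hH : HamiltonianAssumption Ω H β) {x p : Euc d}
    (hx : x ∈ Ω) :
    ContinuousAt (fun z : Euc d × Euc d => gradP H z.1 z.2) (x, p) := by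
  have h1 : ContDiffAt ℝ 2 (fun z : Euc d × Euc d => H z.1 z.2) (x, p) :=
    hH.contDiffOn.contDiffAt
      (prod_mem_nhds (mem_of_superset (hΩ.mem_nhds hx) subset_closure) univ_mem)
  have h2 : ContDiffAt ℝ 2
      (Function.uncurry fun (z : Euc d × Euc d) (q : Euc d) => H z.1 q) ((x, p), p) :=
    h1.comp ((x, p), p) (f := fun z : (Euc d × Euc d) × Euc d => (z.1.1, z.2)) (by fun_prop)
  have h3 : ContDiffAt ℝ 1 (fun z : Euc d × Euc d => fderiv ℝ (fun q => H z.1 q) z.2) (x, p) :=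
    ContDiffAt.fderiv (f := fun (z : Euc d × Euc d) (q : Euc d) => H z.1 q) h2 contDiffAt_snd
      (by norm_num)
  exact (InnerProductSpace.toDual ℝ (Euc d)).symm.continuous.continuousAt.comp h3.continuousAt

/-- Directional limits along the two sides of a `C¹` hypersurface, for a field which vanishes on
the side `{ρ < 0}` and has the limit `w` from the side `{0 < ρ}`. -/
lemma tendsto_indicator_halfSpace_of_sides {E : Type*} [NormedAddCommGroup E]
    [InnerProductSpace ℝ E] {U : Set E} {x₀ n w : E} {ρ : E → ℝ} {J : E → E}
    (hU : U ∈ 𝓝 x₀) (hρ : HasFDerivAt ρ (innerSL ℝ n) x₀) (hρ0 : ρ x₀ = 0)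
    (hL : ∀ x ∈ U, ρ x < 0 → J x = 0) (hR : Tendsto J (𝓝[{x | x ∈ U ∧ 0 < ρ x}] x₀) (𝓝 w))
    {y : E} (hy : ⟪n, y⟫ ≠ 0) :
    Tendsto (fun ε : ℝ => J (x₀ + ε • y)) (𝓝[>] 0)
      (𝓝 ({y : E | 0 < ⟪n, y⟫}.indicator (fun _ => w) y)) := by
  have hcont : Tendsto (fun ε : ℝ => x₀ + ε • y) (𝓝[>] 0) (𝓝 x₀) := by
    have h : Continuous fun ε : ℝ => x₀ + ε • y := by fun_prop
    simpa using (h.tendsto 0).mono_left nhdsWithin_le_nhds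
  -- The sign of `⟪n, y⟫` thus decides on which side the ray eventually lies.
  have hquot : Tendsto (fun ε : ℝ => ε⁻¹ • ρ (x₀ + ε • y)) (𝓝[>] 0) (𝓝 ⟪n, y⟫) := by
    have h1 := (hρ.hasLineDerivAt y).tendsto_slope_zero_right
    simpa [hρ0] using h1
  have hUev := hcont hU
  rcases hy.lt_or_gt with hneg | hpos
  · rw [Set.indicator_of_notMem (by simpa using hneg.le)]
    refine tendsto_const_nhds.congr' ?_
    filter_upwards [hUev, hquot.eventually_lt_const hneg, self_mem_nhdsWithin] with ε h1 h2 h3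
    refine (hL _ h1 ?_).symm
    exact neg_of_smul_neg_left h2 (inv_nonneg.2 (le_of_lt h3))
  · rw [Set.indicator_of_mem (by simpa using hpos)]
    refine hR.comp (tendsto_nhdsWithin_iff.2 ⟨hcont, ?_⟩)
    filter_upwards [hUev, hquot.eventually_const_lt hpos, self_mem_nhdsWithin] with ε h1 h2 h3
    exact ⟨h1, pos_of_smul_pos_left h2 (inv_nonneg.2 (le_of_lt h3))⟩

end MFG

/-! ### The Rankine–Hugoniot condition -/

open scoped RealInnerProductSpace

theorem mainTheorem8 {d : ℕ} (Ω : Set (MFG.Euc d))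
    (hΩo : IsOpen Ω) (hΩb : Bornology.IsBounded Ω) (hΩc : IsConnected Ω)
    (G : ℝ → ℝ) (H : MFG.Euc d → MFG.Euc d → ℝ) (α β : ℝ)
    (hG : MFG.EnergyAssumption G α) (hH : MFG.HamiltonianAssumption Ω H β)
    (m u : MFG.Euc d → ℝ) (v : MFG.Euc d → MFG.Euc d)
    (hsol : MFG.IsWeakSolution Ω G H α β m u v)
    (x₀ : MFG.Euc d) (hx₀ : x₀ ∈ MFG.freeBoundary Ω m)
    (U VL VR : Set (MFG.Euc d)) (ρ : MFG.Euc d → ℝ) (hUΩ : U ⊆ Ω)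
    (hdiv : MFG.DividesC1 (MFG.freeBoundary Ω m) x₀ U VL VR ρ)
    (hL : ∀ x ∈ VL, m x = 0) (hR : ∀ x ∈ VR, 0 < m x)
    (ν : MFG.Euc d) (hν : MFG.IsUnitNormal ρ x₀ ν)
    (mR : ℝ) (hmR : Tendsto m (𝓝[VR] x₀) (𝓝 mR))
    (vR : MFG.Euc d) (hvR : Tendsto v (𝓝[VR] x₀) (𝓝 vR)) :
    inner ℝ (mR • MFG.gradP H x₀ vR) ν = 0 := by
  have hUx : U ∈ 𝓝 x₀ := hdiv.isOpen.mem_nhds hdiv.mem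
  have hxΩ : x₀ ∈ Ω := hUΩ hdiv.mem
  obtain rfl := hdiv.left_eq
  obtain rfl := hdiv.right_eq
  set J : MFG.Euc d → MFG.Euc d := fun x => m x • MFG.gradP H x (v x) with hJ
  set w := mR • MFG.gradP H x₀ vR with hw
  set n := gradient ρ x₀ with hn
  have hn0 : n ≠ 0 := hdiv.gradient_ne_zero x₀ hdiv.mem
  have hρ0 : ρ x₀ = 0 := by
    have : x₀ ∈ MFG.freeBoundary Ω m ∩ U := ⟨hx₀, hdiv.mem⟩
    rw [hdiv.eq_zero] at this
    exact this.2
  have hρs : HasStrictFDerivAt ρ (innerSL ℝ n) x₀ := by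
    have h := (hdiv.contDiffOn.contDiffAt hUx).hasStrictFDerivAt one_ne_zero
    have hin : innerSL ℝ n = fderiv ℝ ρ x₀ := by
      refine ContinuousLinearMap.ext fun y => ?_
      rw [innerSL_apply_apply, hn, inner_gradient_left]
    rwa [hin]
  have hJlim : Tendsto J (𝓝[{x | x ∈ U ∧ 0 < ρ x}] x₀) (𝓝 w) :=
    hmR.smul ((hH.continuousAt_gradP hΩo (p := vR) hxΩ).tendsto.comp
      ((tendsto_id.mono_left nhdsWithin_le_nhds).prodMk_nhds hvR))
  have hJL : ∀ x ∈ U, ρ x < 0 → J x = 0 := fun x hx hρx => by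
    simp [hJ, hL x ⟨hx, hρx⟩]
  -- The values of `J` on `{ρ = 0}` are uncontrolled, so the bound holds only off this null set.
  have hJb : ∃ δ > 0, ∀ᵐ x, x ∈ Metric.ball x₀ δ → ‖J x‖ ≤ ‖w‖ + 1 := by
    obtain ⟨s, hs, hs0⟩ := MFG.exists_nhds_measure_inter_zeroSet_eq_zero volume hρs (by
      intro h
      apply hn0
      have := congrArg (fun L => L n) h
      simpa using this)
    have hJR : ∀ᶠ x in 𝓝 x₀, (x ∈ U ∧ 0 < ρ x) → ‖J x‖ ≤ ‖w‖ + 1 :=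
      eventually_nhdsWithin_iff.1 (hJlim.norm.eventually_le_const (lt_add_one _))
    obtain ⟨δ, hδ, hball⟩ := Metric.mem_nhds_iff.1 (inter_mem (inter_mem hs hUx) hJR)
    refine ⟨δ, hδ, ?_⟩
    filter_upwards [measure_eq_zero_iff_ae_notMem.1 hs0] with x hx hxb
    obtain ⟨⟨hxs, hxU⟩, hxJ⟩ := hball hxb
    rcases lt_trichotomy (ρ x) 0 with h | h | h
    · rw [hJL x hxU h, norm_zero]
      positivity
    · exact absurd ⟨hxs, h⟩ hx
    · exact hxJ ⟨hxU, h⟩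
  obtain ⟨δ, hδ, hJδ⟩ := hJb
  have hlim : ∀ᵐ y : MFG.Euc d, Tendsto (fun ε : ℝ => J (x₀ + ε • y)) (𝓝[>] 0)
      (𝓝 ({y : MFG.Euc d | 0 < ⟪n, y⟫}.indicator (fun _ => w) y)) := by
    -- Directions `y` tangent to the hypersurface, where the ray limit is unknown, form a null
    -- hyperplane.
    have hnull := Measure.addHaar_submodule (volume : Measure (MFG.Euc d))
      (LinearMap.ker (innerSL ℝ n).toLinearMap) (by
        intro h
        have : n ∈ LinearMap.ker (innerSL ℝ n).toLinearMap := h ▸ Submodule.mem_top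
        simp [hn0] at this)
    filter_upwards [measure_eq_zero_iff_ae_notMem.1 hnull] with y hy
    exact MFG.tendsto_indicator_halfSpace_of_sides hUx hρs.hasFDerivAt hρ0 hJL hJlim
      (by simpa using hy)
  have key : ⟪n, w⟫ = 0 := by
    refine MFG.inner_eq_zero_of_setIntegral_halfSpace_eq_zero volume fun φ hφ hc => ?_
    refine MFG.setIntegral_eq_zero_of_blowUp volume hΩo hsol.flux_integrable hxΩ ?_ hδ hJδ
      (isOpen_lt continuous_const (by fun_prop)).measurableSet hlim hφ hc
    intro ψ hψ hψc hψΩ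
    rw [← hsol.continuity ψ ⟨hψ, hψc, hψΩ⟩]
    congr 1
    ext x
    simp [inner_gradient_right]
  obtain ⟨-, c, rfl⟩ := hν
  rw [inner_smul_right, real_inner_comm, key, mul_zero]
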